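/- **Theorem (Existence).** Let $f$ be a function that is analytic for $\Re(t)>0$ and at $t=0$, that grows at most polynomially as $t\to+\infty$ (i.e. $f(t)=O(t^p)$ for some $p\in\mathbb{N}$), and such that $f(t)>0$ for all real $t\ge 0$. Let $M,N\in\mathbb{N}=\{0,1,2,\dots\}$ with $M\le N$, and let $b=(b_k)_{k\ge 0}$ be a sequence of positive real numbers. For $\Re(w)>0$ let $\zeta_M(s,w)$ be the analytic continuation in $s$ to $\mathbb{C}\setminus\{1,\dots,M\}$ of $$\zeta_M(s,w)=\frac{1}{\Gamma(s)}\int_0^\infty t^{s-1}e^{-wt}f(t)\,\frac{dt}{t^M},\qquad \Re(s)>M,$$ and let $L_M(w)=\partial_s\zeta_M(s,w)|_{s=0}$. For a function $g$ define $$(\mathcal{S}_N g)(q\,|\,b)=\sum_{p=0}^N(-1)^p\sum_{1\le k_1<\dots<k_p\le N} g\bigl(q+b_0+b_{k_1}+\dots+b_{k_p}\bigr),$$ and, for $\Re(q)>-b_0$, let $$\eta_{M,N}(q\,|\,b)=\exp\bigl((\mathcal{S}_NL_M)(q\,|\,b)-(\mathcal{S}_NL_M)(0\,|\,b)\bigr).$$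 Then $\eta_{M,N}(q\,|\,b)$ is the Mellin transform of a probability distribution on $(0,1]$: there is a random variable $\beta_{M,N}(b)$ with values in $(0,1]$ such that $$\mathbf{E}\bigl[\beta_{M,N}(b)^q\bigr]=\eta_{M,N}(q\,|\,b),\qquad \Re(q)>-b_0,$$ where the expectation converges absolutely. Moreover, the distribution of $-\log\beta_{M,N}(b)$ is infinitely divisible on $[0,\infty)$ (for every $n\ge1$ it is the law of a sum of $n$ i.i.d. $[0,\infty)$-valued random variables), and it has the Lévy–Khinchine decomposition $$\mathbf{E}\Bigl[\exp\bigl(-q\log\beta_{M,N}(b)\bigr)\Bigr]=\exp\Bigl(\int_0^\infty(e^{tq}-1)\,e^{-b_0t}\prod_{j=1}^N(1-e^{-b_jt})\,\frac{f(t)}{t^{M+1}}\,dt\Bigr),\qquad \Re(q)<b_0,$$ where the expectation and the integral converge absolutely and the density $k(t)=e^{-b_0t}\prod_{j=1}^N(1-e^{-b_jt})f(t)/t^{M+1}$ is that of a Lévy measure on $(0,\infty)$, i.e. $k\ge0$ and $\int_0^\infty\min(1,t)\,k(t)\,dt<\infty$. -/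

import Mathlib

open MeasureTheory Set

noncomputable section

/-- The Ruijsenaars class: functions that are analytic in the open right half-plane and at the
origin, and that grow at most polynomially as `t → ∞`. The growth condition is only imposed
along the positive real axis, which is the path of all the integrals below. -/
structure IsRuijsenaars (f : ℂ → ℂ) : Prop where
  analyticAt_of_re_pos : ∀ t : ℂ, 0 < t.re → AnalyticAt ℂ f t
  analyticAt_zero : AnalyticAt ℂ f 0
  polynomial_growth : ∃ p : ℕ, (fun t : ℝ => f t) =O[Filter.atTop] (fun t : ℝ => t ^ p)

/-- The integral `Γ(s)⁻¹ ∫₀^∞ t ^ (s - 1) e ^ (-w t) f(t) t ^ (-M) dt`, which converges for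
`Re s > M` and `Re w > 0`. -/
def zetaIntegral (f : ℂ → ℂ) (M : ℕ) (w s : ℂ) : ℂ :=
  (Complex.Gamma s)⁻¹ * mellin (fun t : ℝ => Complex.exp (-w * t) * f t / (t : ℂ) ^ M) s

/-- The possible poles `1, 2, …, M` of the generalized zeta function. -/
def zetaPoles (M : ℕ) : Set ℂ := (fun k : ℕ => (k : ℂ)) '' Set.Icc 1 M

/-- `Z` is an analytic continuation in `s` of the zeta integral from `Re s > M` to the complex
plane without the points `1, …, M`. -/
def IsZetaContinuation (f : ℂ → ℂ) (M : ℕ) (w : ℂ) (Z : ℂ → ℂ) : Prop :=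
  AnalyticOnNhd ℂ Z (zetaPoles M)ᶜ ∧ ∀ s : ℂ, (M : ℝ) < s.re → Z s = zetaIntegral f M w s

/-- The continuation is unique off the points `1, …, M`. -/
theorem IsZetaContinuation.eqOn {f : ℂ → ℂ} {M : ℕ} {w : ℂ} {Z Z' : ℂ → ℂ}
    (h : IsZetaContinuation f M w Z) (h' : IsZetaContinuation f M w Z') :
    EqOn Z Z' (zetaPoles M)ᶜ := by
  have hc : (zetaPoles M).Countable := ((Set.finite_Icc 1 M).image _).countable
  have hconn : IsPreconnected (zetaPoles M)ᶜ :=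
    (hc.isConnected_compl_of_one_lt_rank (by simp [Complex.rank_real_complex])).isPreconnected
  have hmem : ((M : ℂ) + 1) ∈ (zetaPoles M)ᶜ := by
    rintro ⟨k, hk, hkM⟩
    have hkM2 : (k : ℂ) = (M : ℂ) + 1 := hkM
    have : k = M + 1 := by exact_mod_cast hkM2
    have := hk.2
    omega
  refine h.1.eqOn_of_preconnected_of_eventuallyEq h'.1 hconn hmem ?_
  have ho : IsOpen {s : ℂ | (M : ℝ) < s.re} := isOpen_lt continuous_const Complex.continuous_re
  filter_upwards [ho.mem_nhds (show ((M : ℂ) + 1) ∈ {s : ℂ | (M : ℝ) < s.re} by simp)] with s hs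
  rw [h.2 s hs, h'.2 s hs]

open Classical in
/-- The generalized zeta function `ζ_M(s, w)`, for `Re w > 0`, as a function on the whole
`s`-plane (without the points `1, …, M`), defined by analytic continuation. -/
def genZeta (f : ℂ → ℂ) (M : ℕ) (s w : ℂ) : ℂ :=
  if h : ∃ Z : ℂ → ℂ, IsZetaContinuation f M w Z then h.choose s else 0

/-- The generalized log-gamma function `L_M(w) = ∂ₛ ζ_M(s, w)` at `s = 0`, for `Re w > 0`. -/
def genLogGamma (f : ℂ → ℂ) (M : ℕ) (w : ℂ) : ℂ :=
  deriv (fun s : ℂ => genZeta f M s w) 0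

/-- The combinatorial operator `𝒮_N`: the alternating sum of the values
`g (q + b₀ + b_{k₁} + ⋯ + b_{kₚ})` over all `1 ≤ k₁ < ⋯ < kₚ ≤ N` and `0 ≤ p ≤ N`. -/
def altSum (N : ℕ) (b : ℕ → ℝ) (g : ℂ → ℂ) (q : ℂ) : ℂ :=
  ∑ p ∈ Finset.range (N + 1), (-1 : ℂ) ^ p *
    ∑ K ∈ Finset.powersetCard p (Finset.Icc 1 N), g (q + b 0 + ∑ k ∈ K, (b k : ℂ))

/-- `η_{M,N}(q | b) = exp ((𝒮_N L_M)(q | b) - (𝒮_N L_M)(0 | b))`, for `Re q > -b₀`. -/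
def barnesEta (f : ℂ → ℂ) (M N : ℕ) (b : ℕ → ℝ) (q : ℂ) : ℂ :=
  Complex.exp (altSum N b (genLogGamma f M) q - altSum N b (genLogGamma f M) 0)

/-- The function `e ^ (-b₀ t) ∏_{j=1}^N (1 - e ^ (-b_j t)) f(t) / t ^ (M + 1)` of `t > 0`, for `f`
that is real on the positive axis. -/
def levyDensity (f : ℂ → ℂ) (M N : ℕ) (b : ℕ → ℝ) (t : ℝ) : ℝ :=
  Real.exp (-b 0 * t) * (∏ j ∈ Finset.Icc 1 N, (1 - Real.exp (-b j * t))) * (f t).re / t ^ (M + 1)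

/-- `k` is the density on `(0, ∞)` of the Lévy measure of a distribution on `[0, ∞)`. -/
def IsLevyDensity (k : ℝ → ℝ) : Prop :=
  (∀ t : ℝ, 0 < t → 0 ≤ k t) ∧ IntegrableOn (fun t : ℝ => min 1 t * k t) (Ioi 0)

/-- A probability measure `ν` on `ℝ` is infinitely divisible on `[0, ∞)`: it is carried by
`[0, ∞)` and, for all `n ≥ 1`, it is the law of a sum of `n` independent random variables with a
common distribution `ρ` on `[0, ∞)`. -/
def InfinitelyDivisibleOnNonneg (ν : Measure ℝ) : Prop :=
  IsProbabilityMeasure ν ∧ ν (Ici 0) = 1 ∧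
    ∀ n : ℕ, 1 ≤ n → ∃ ρ : Measure ℝ, IsProbabilityMeasure ρ ∧ ρ (Ici 0) = 1 ∧
      (Measure.pi (fun _ : Fin n => ρ)).map (fun x => ∑ i, x i) = ν

end

/-! The exponent of `barnesEta` is a Lévy–Khinchine exponent in disguise. Applied to `w ↦ e^{-wt}`,
the operator `altSum` produces `e^{-(q+b₀)t} ∏ (1 - e^{-b_j t})` (`altSum_exp`), which vanishes to
order `N` at `t = 0`; subtracting the value at `q = 0` gains one more zero. Since `N + 1 ≥ M + 1`,
the Mellin integral of the combined zeta function converges for `Re s > -1`. There `1/Γ` vanishes at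
`s = 0` with derivative `1`, so the `s`-derivative at `0` is `∫ (e^{-qt} - 1) k(t) dt` with `k` the
Lévy density (`IsRuijsenaars.altSum_genLogGamma_sub`). The individual zeta functions do need
continuation to `s = 0`: Taylor polynomials are subtracted on `(0, 1]` and their Mellin transforms
added back (`RapidDecayWithExpansion.exists_continuation`). The identity theorem then compares the
two descriptions.

On the probabilistic side, `k` may have infinite mass near `0`, so the measure `k dt` is cut into
countably many finite pieces. The sum of independent compound Poisson variables with these
intensities converges almost surely and has the required exponential moments
(`exists_isProbabilityMeasure_integral_cexp_eq`). If `X` is that sum, then `e^{-X}` has the law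
sought; replacing `k` by `k / n` gives the `n`-th convolution root. -/

open ProbabilityTheory Filter Topology Asymptotics
open scoped NNReal ENNReal

/-! ### Compound Poisson laws with finite intensity. -/

section CompoundPoisson

variable {E 𝕜 : Type*} [AddCommMonoid E] [MeasurableSpace E] [MeasurableAdd₂ E] [RCLike 𝕜]

/-- The `n`-fold convolution power of a measure on an additive monoid. -/
noncomputable def convPow (Λ : Measure E) : ℕ → Measure E
  | 0 => Measure.dirac 0
  | n + 1 => Λ.conv (convPow Λ n)

instance convPow.isFiniteMeasure (Λ : Measure E) [IsFiniteMeasure Λ] (n : ℕ) :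
    IsFiniteMeasure (convPow Λ n) := by
  induction n with
  | zero => unfold convPow; infer_instance
  | succ n ih => unfold convPow; infer_instance

/-- Multiplicative functions integrate multiplicatively against convolution powers. -/
theorem integrable_convPow_and_integral_eq_pow (Λ : Measure E) [IsFiniteMeasure Λ] {φ : E → 𝕜}
    (hφ : Measurable φ) (h0 : φ 0 = 1) (hadd : ∀ x y, φ (x + y) = φ x * φ y)
    (hint : Integrable φ Λ) (n : ℕ) :
    Integrable φ (convPow Λ n) ∧ ∫ x, φ x ∂convPow Λ n = (∫ x, φ x ∂Λ) ^ n := by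
  induction n with
  | zero =>
    refine ⟨integrable_dirac' hφ.stronglyMeasurable (by simp), ?_⟩
    simp [convPow, integral_dirac' _ _ hφ.stronglyMeasurable, h0]
  | succ n ih =>
    have hi : Integrable φ (convPow Λ (n + 1)) := by
      unfold convPow Measure.conv
      rw [integrable_map_measure hφ.aestronglyMeasurable (by fun_prop)]
      simpa only [Function.comp_def, hadd] using hint.mul_prod ih.1
    refine ⟨hi, ?_⟩
    unfold convPow at hi ⊢
    rw [integral_conv hi]
    simp_rw [hadd, integral_const_mul, integral_mul_const, ih.2]
    ring

/-- The compound Poisson distribution with a given finite intensity measure. -/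
noncomputable def compoundPoisson (Λ : Measure E) : Measure E :=
  Measure.sum fun n : ℕ =>
    ENNReal.ofReal (Real.exp (-Λ.real univ) / n.factorial) • convPow Λ n

/-- The `n`-fold convolution contributes `(∫ φ)^n / n!`, so the exponential series appears; the
normalising factor `e^{-Λ(E)}` turns `∫ φ` into `∫ (φ - 1)`. -/
theorem integrable_compoundPoisson_and_integral_eq_exp (Λ : Measure E) [IsFiniteMeasure Λ]
    {φ : E → 𝕜} (hφ : Measurable φ) (h0 : φ 0 = 1) (hadd : ∀ x y, φ (x + y) = φ x * φ y)
    (hint : Integrable φ Λ) :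
    Integrable φ (compoundPoisson Λ) ∧
      ∫ x, φ x ∂compoundPoisson Λ = NormedSpace.exp (∫ x, (φ x - 1) ∂Λ) := by
  have hc : ∀ n : ℕ, (0 : ℝ) ≤ Real.exp (-Λ.real univ) / n.factorial := fun n => by positivity
  have hi : Integrable φ (compoundPoisson Λ) := by
    refine integrable_sum_measure (fun n => ?_) ?_
    · exact (integrable_convPow_and_integral_eq_pow Λ hφ h0 hadd hint n).1.smul_measure (by simp)
    -- The norm of a multiplicative function is multiplicative, so the norms also sum to an
    -- exponential series.
    · have hn := fun n => (integrable_convPow_and_integral_eq_pow Λ (φ := fun x => ‖φ x‖) hφ.norm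
        (by simp [h0]) (by simp [hadd]) hint.norm n).2
      simp_rw [integral_smul_measure, hn, ENNReal.toReal_ofReal (hc _), smul_eq_mul]
      refine ((Real.summable_pow_div_factorial (∫ x, ‖φ x‖ ∂Λ)).mul_left
        (Real.exp (-Λ.real univ))).congr fun n => ?_
      ring
  refine ⟨hi, ?_⟩
  have h1 := hasSum_integral_measure hi
  have hn := fun n => (integrable_convPow_and_integral_eq_pow Λ hφ h0 hadd hint n).2
  simp_rw [integral_smul_measure, hn, ENNReal.toReal_ofReal (hc _)] at h1
  have h2 := (NormedSpace.expSeries_div_hasSum_exp (∫ x, φ x ∂Λ)).const_smul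
    (Real.exp (-Λ.real univ))
  have h3 : ∀ n : ℕ, (Real.exp (-Λ.real univ) / n.factorial) • (∫ x, φ x ∂Λ) ^ n
      = Real.exp (-Λ.real univ) • ((∫ x, φ x ∂Λ) ^ n / n.factorial) := fun n => by
    simp only [RCLike.real_smul_eq_coe_mul]
    push_cast
    ring
  simp_rw [h3] at h1
  rw [compoundPoisson, h1.unique h2, integral_sub hint (integrable_const _), sub_eq_add_neg,
    add_comm, NormedSpace.exp_add, RCLike.real_smul_eq_coe_mul]
  congr 1
  rw [Real.exp_eq_exp_ℝ]
  have h4 := NormedSpace.algebraMap_exp_comm (𝕂 := ℝ) (𝔸 := 𝕜) (-Λ.real univ)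
  simp only [RCLike.algebraMap_eq_ofReal, RCLike.ofReal_neg] at h4
  rw [h4, integral_const, RCLike.real_smul_eq_coe_mul, mul_one]

instance compoundPoisson.isProbabilityMeasure (Λ : Measure E) [IsFiniteMeasure Λ] :
    IsProbabilityMeasure (compoundPoisson Λ) := by
  -- For `φ = 1` the exponent is `0`, so the total mass is `1`.
  have h := integrable_compoundPoisson_and_integral_eq_exp Λ (φ := fun _ => (1 : ℝ))
    measurable_const rfl (by simp) (integrable_const _)
  refine ⟨?_⟩
  have h2 := h.2
  simp only [integral_const, sub_self, smul_eq_mul, mul_zero, NormedSpace.exp_zero,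
    mul_one, measureReal_def] at h2
  rwa [ENNReal.toReal_eq_one_iff] at h2

end CompoundPoisson

/-! ### Infinite sums of independent compound Poisson variables. -/

section InfiniteSum

variable {𝕜 : Type*} [RCLike 𝕜]

theorem integral_infinitePi_compoundPoisson_range_sum (Λ : ℕ → Measure ℝ≥0)
    [∀ i, IsFiniteMeasure (Λ i)] {φ : ℝ≥0 → 𝕜} (hφ : Measurable φ) (h0 : φ 0 = 1)
    (hadd : ∀ x y, φ (x + y) = φ x * φ y) (hint : ∀ i, Integrable φ (Λ i)) (n : ℕ) :
    ∫ ω, φ (∑ i ∈ Finset.range n, ω i) ∂Measure.infinitePi (fun i => compoundPoisson (Λ i)) =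
      NormedSpace.exp (∑ i ∈ Finset.range n, ∫ x, (φ x - 1) ∂Λ i) := by
  have hsum : ∀ (s : Finset ℕ) (x : ℕ → ℝ≥0), φ (∑ i ∈ s, x i) = ∏ i ∈ s, φ (x i) := fun s x => by
    induction s using Finset.induction_on with
    | empty => simp [h0]
    | insert a s ha ih => rw [Finset.sum_insert ha, Finset.prod_insert ha, hadd, ih]
  have hind : iIndepFun (fun (i : Fin n) (ω : ℕ → ℝ≥0) => φ (ω i))
      (Measure.infinitePi (fun i => compoundPoisson (Λ i))) :=
    (iIndepFun_infinitePi (P := fun i => compoundPoisson (Λ i)) (X := fun _ => φ)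
      fun _ => hφ).precomp Fin.val_injective
  have hm : ∀ i : ℕ, Measurable fun ω : ℕ → ℝ≥0 => φ (ω i) :=
    fun i => hφ.comp (measurable_pi_apply i)
  simp_rw [hsum, Finset.prod_range]
  rw [hind.integral_fun_prod_eq_prod_integral fun i => (hm i).aestronglyMeasurable,
    Finset.sum_range, NormedSpace.exp_sum]
  refine Finset.prod_congr rfl fun i _ => ?_
  rw [← (integrable_compoundPoisson_and_integral_eq_exp (Λ i) hφ h0 hadd (hint i)).2,
    ← Measure.infinitePi_map_eval (fun i => compoundPoisson (Λ i)) (i : ℕ),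
    integral_map (φ := fun x : ℕ → ℝ≥0 => x i) (measurable_pi_apply _).aemeasurable
      hφ.aestronglyMeasurable]


/-- Mean value inequality on the half-plane `Re z ≤ max (Re w) 0`, which is convex and contains `0`
and `w`. -/
theorem norm_cexp_sub_one_le (w : ℂ) : ‖Complex.exp w - 1‖ ≤ ‖w‖ * Real.exp (max w.re 0) := by
  have h := (convex_halfSpace_re_le (max w.re 0)).norm_image_sub_le_of_norm_hasDerivWithin_le
    (f := Complex.exp) (f' := Complex.exp) (C := Real.exp (max w.re 0)) (x := 0) (y := w)
    (fun z _ => (Complex.hasDerivAt_exp z).hasDerivWithinAt)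
    (fun z hz => by rw [Complex.norm_exp]; exact Real.exp_le_exp.2 hz) (by simp) (by simp)
  simpa [mul_comm] using h

theorem integrable_cexp_mul_sub_one {Λ : Measure ℝ≥0} {c : ℝ} (hc : 0 < c)
    (hΛ : ∀ a < c, Integrable (fun t : ℝ≥0 => (t : ℝ) * Real.exp (a * t)) Λ) {z : ℂ}
    (hz : z.re < c) : Integrable (fun t : ℝ≥0 => Complex.exp (z * (t : ℝ)) - 1) Λ := by
  refine ((hΛ (max z.re 0) (by simp [hz, hc])).const_mul ‖z‖).mono'
    (by fun_prop) (ae_of_all _ fun t => ?_)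
  refine (norm_cexp_sub_one_le _).trans_eq ?_
  have h : max (z * (t : ℝ)).re 0 = max z.re 0 * t := by
    rw [max_mul_of_nonneg _ _ t.coe_nonneg]; simp
  rw [h]
  simp [mul_assoc]

/-- The law is that of `∑ ωᵢ` with independent compound Poisson `ωᵢ` whose intensities are finite
and sum to `Λ`. Monotone convergence bounds the real exponential moments of the partial sums; this
gives almost sure convergence and a dominating function for complex `z`. -/
theorem exists_isProbabilityMeasure_integral_cexp_eq (Λ : Measure ℝ≥0) [SFinite Λ] {c : ℝ}
    (hc : 0 < c) (hΛ : ∀ a < c, Integrable (fun t : ℝ≥0 => (t : ℝ) * Real.exp (a * t)) Λ) :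
    ∃ ν : Measure ℝ≥0, IsProbabilityMeasure ν ∧ ∀ z : ℂ, z.re < c →
      Integrable (fun x : ℝ≥0 => Complex.exp (z * (x : ℝ))) ν ∧
      ∫ x : ℝ≥0, Complex.exp (z * (x : ℝ)) ∂ν =
        Complex.exp (∫ t : ℝ≥0, (Complex.exp (z * (t : ℝ)) - 1) ∂Λ) := by
  set L := sfiniteSeq Λ
  have hL : Measure.sum L = Λ := sum_sfiniteSeq Λ
  have hLi : ∀ i (z : ℂ), z.re < c →
      Integrable (fun t : ℝ≥0 => Complex.exp (z * (t : ℝ))) (L i) := fun i z hz => by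
    -- Only `e^{zt} - 1` is integrable against `Λ`; the constant `1` can be added back because `L i`
    -- is finite.
    have h1 := (integrable_cexp_mul_sub_one hc hΛ hz).mono_measure
      (ν := Λ) (μ := L i) (hL ▸ Measure.le_sum L i)
    exact (h1.add (integrable_const 1)).congr (ae_of_all _ fun t => by simp)
  have hreal : ∀ a : ℝ, a < c → Integrable (fun t : ℝ≥0 => Real.exp (a * t) - 1) Λ := fun a ha => by
    have h := (integrable_cexp_mul_sub_one hc hΛ (z := a) (by simpa)).re
    refine h.congr (ae_of_all _ fun t => ?_)
    simp [← Complex.ofReal_mul, ← Complex.ofReal_exp]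
  have hLr : ∀ i (a : ℝ), a < c → Integrable (fun t : ℝ≥0 => Real.exp (a * t)) (L i) :=
      fun i a ha => by
    have h1 := (hreal a ha).mono_measure (ν := Λ) (μ := L i) (hL ▸ Measure.le_sum L i)
    exact (h1.add (integrable_const 1)).congr (ae_of_all _ fun t => by simp)
  set P := Measure.infinitePi (fun i => compoundPoisson (L i))
  set S : ℕ → (ℕ → ℝ≥0) → ℝ≥0 := fun n ω => ∑ i ∈ Finset.range n, ω i
  set X : (ℕ → ℝ≥0) → ℝ≥0 := fun ω => ∑' i, ω i
  have hX : Measurable X := Measurable.tsum fun i => measurable_pi_apply i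
  have hSm : ∀ n, Measurable (S n) := fun n => by fun_prop
  have hSr : ∀ a : ℝ, a < c → ∀ n, ∫ ω, Real.exp (a * S n ω) ∂P =
      Real.exp (∑ i ∈ Finset.range n, ∫ t : ℝ≥0, (Real.exp (a * t) - 1) ∂L i) := fun a ha n => by
    have h := integral_infinitePi_compoundPoisson_range_sum L
      (φ := fun t : ℝ≥0 => Real.exp (a * t)) (by fun_prop) (by simp)
      (fun x y => by simp [mul_add, Real.exp_add]) (fun i => hLr i a ha) n
    rwa [← Real.exp_eq_exp_ℝ] at h
  have hSc : ∀ z : ℂ, z.re < c → ∀ n, ∫ ω, Complex.exp (z * (S n ω : ℝ)) ∂P =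
      Complex.exp (∑ i ∈ Finset.range n, ∫ t : ℝ≥0, (Complex.exp (z * (t : ℝ)) - 1) ∂L i) :=
      fun z hz n => by
    have h := integral_infinitePi_compoundPoisson_range_sum L
      (φ := fun t : ℝ≥0 => Complex.exp (z * (t : ℝ))) (by fun_prop) (by simp)
      (fun x y => by simp [mul_add, Complex.exp_add]) (fun i => hLi i z hz) n
    rwa [← Complex.exp_eq_exp_ℂ] at h
  have hSi : ∀ a : ℝ, a < c → ∀ n, Integrable (fun ω => Real.exp (a * S n ω)) P := fun a ha n => by
    -- The integral of a non-integrable function is `0` by convention, whereas the computed value is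
    -- an exponential.
    by_contra h
    have h2 := hSr a ha n
    rw [integral_undef h] at h2
    exact (Real.exp_pos _).ne h2
  have hsup : ∀ a : ℝ, 0 ≤ a → a < c →
      ∫⁻ ω, ⨆ n, ENNReal.ofReal (Real.exp (a * S n ω)) ∂P < ∞ := fun a ha0 ha => by
    have hmono : ∀ ω, Monotone fun n => S n ω := fun ω =>
      Finset.sum_mono_set_of_nonneg (fun _ => zero_le) |>.comp Finset.range_mono
    rw [lintegral_iSup (fun n => by fun_prop) fun m n hmn ω =>
      ENNReal.ofReal_le_ofReal (Real.exp_le_exp.2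
        (mul_le_mul_of_nonneg_left (NNReal.coe_le_coe.2 (hmono ω hmn)) ha0))]
    refine (iSup_le fun n => ?_ : _ ≤
      ENNReal.ofReal (Real.exp (∫ t : ℝ≥0, (Real.exp (a * t) - 1) ∂Λ))).trans_lt
        ENNReal.ofReal_lt_top
    rw [← ofReal_integral_eq_lintegral_ofReal (hSi a ha n)
      (ae_of_all _ fun _ => (Real.exp_pos _).le), hSr a ha n]
    refine ENNReal.ofReal_le_ofReal (Real.exp_le_exp.2 ?_)
    have hs := hasSum_integral_measure (hL.symm ▸ hreal a ha :
      Integrable (fun t : ℝ≥0 => Real.exp (a * t) - 1) (Measure.sum L))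
    rw [hL] at hs
    refine sum_le_hasSum _ (fun i _ => integral_nonneg fun t => ?_) hs
    simpa using mul_nonneg ha0 t.coe_nonneg
  have hsumm : ∀ᵐ ω ∂P, Summable ω := by
    -- Any exponent in `(0, c)` would do in place of `c / 2`: a finite supremum of `e^{aSₙ}` with `a
    -- > 0` bounds the partial sums.
    have hm : Measurable fun ω => ⨆ n, ENNReal.ofReal (Real.exp (c / 2 * S n ω)) := by fun_prop
    filter_upwards [ae_lt_top hm (hsup (c / 2) (by linarith) (by linarith)).ne] with ω hω
    rw [← NNReal.summable_coe]
    refine summable_of_sum_range_le (c := (⨆ n, ENNReal.ofReal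
      (Real.exp (c / 2 * S n ω))).toReal / (c / 2)) (fun _ => NNReal.coe_nonneg _) fun n => ?_
    rw [le_div_iff₀' (by linarith)]
    have h1 := ENNReal.toReal_mono hω.ne
      (le_iSup (fun n => ENNReal.ofReal (Real.exp (c / 2 * S n ω))) n)
    rw [ENNReal.toReal_ofReal (Real.exp_pos _).le] at h1
    have h2 := Real.add_one_le_exp (c / 2 * S n ω)
    have h3 : ((S n ω : ℝ≥0) : ℝ) = ∑ i ∈ Finset.range n, (ω i : ℝ) := by simp [S]
    rw [← h3]
    linarith
  -- Only almost everywhere: off the summable set, `X` takes the default value `0`.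
  have hlim : ∀ᵐ ω ∂P, Tendsto (fun n => (S n ω : ℝ)) atTop (𝓝 (X ω)) :=
    hsumm.mono fun ω hω => (NNReal.tendsto_coe.2 hω.hasSum.tendsto_sum_nat)
  have hXi : ∀ a : ℝ, 0 ≤ a → a < c → Integrable (fun ω => Real.exp (a * X ω)) P :=
      fun a ha0 ha => by
    refine ⟨by fun_prop, ?_⟩
    rw [hasFiniteIntegral_iff_ofReal (ae_of_all _ fun _ => (Real.exp_pos _).le)]
    refine (lintegral_mono_ae ?_).trans_lt (hsup a ha0 ha)
    filter_upwards [hlim] with ω hω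
    exact le_of_tendsto' (ENNReal.tendsto_ofReal ((Real.continuous_exp.tendsto _).comp
      (hω.const_mul a))) fun n => le_iSup (fun n => ENNReal.ofReal (Real.exp (a * S n ω))) n
  refine ⟨P.map X, Measure.isProbabilityMeasure_map hX.aemeasurable, fun z hz => ?_⟩
  have hbound : ∀ x y : ℝ≥0, x ≤ y →
      ‖Complex.exp (z * (x : ℝ))‖ ≤ Real.exp (max z.re 0 * y) := fun x y hxy => by
    rw [Complex.norm_exp]
    refine Real.exp_le_exp.2 ?_
    simpa using mul_le_mul (le_max_left z.re 0) (NNReal.coe_le_coe.2 hxy) x.coe_nonneg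
      (le_max_right _ _)
  have hdom := hXi (max z.re 0) (le_max_right _ _) (max_lt hz hc)
  rw [integrable_map_measure (by fun_prop) hX.aemeasurable,
    integral_map hX.aemeasurable (by fun_prop)]
  refine ⟨hdom.mono' (by fun_prop) (ae_of_all _ fun ω => hbound _ _ le_rfl), ?_⟩
  have h1 : Tendsto (fun n => ∫ ω, Complex.exp (z * (S n ω : ℝ)) ∂P) atTop
      (𝓝 (∫ ω, Complex.exp (z * (X ω : ℝ)) ∂P)) := by
    refine tendsto_integral_of_dominated_convergence _ (fun n => by fun_prop) hdom (fun n => ?_) ?_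
    · filter_upwards [hsumm] with ω hω
      exact hbound _ _ (hω.sum_le_tsum _ fun _ _ => zero_le)
    · filter_upwards [hlim] with ω hω
      exact (Complex.continuous_exp.tendsto _).comp
        (((Complex.continuous_ofReal.tendsto _).comp hω).const_mul z)
  simp_rw [hSc z hz] at h1
  have hs := hasSum_integral_measure (hL.symm ▸ integrable_cexp_mul_sub_one hc hΛ hz :
    Integrable (fun t : ℝ≥0 => Complex.exp (z * (t : ℝ)) - 1) (Measure.sum L))
  rw [hL] at hs
  exact tendsto_nhds_unique h1 ((Complex.continuous_exp.tendsto _).comp hs.tendsto_sum_nat)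

end InfiniteSum

/-! ### Continuation of Mellin transforms by subtracting Taylor polynomials. -/

section Continuation

/-- The remainder of `g` after subtraction, on `(0, 1]`, of the polynomial with
coefficients `a 0, …, a (K - 1)`. -/
noncomputable def taylorRemainder (g : ℝ → ℂ) (a : ℕ → ℂ) (K : ℕ) (t : ℝ) : ℂ :=
  g t - indicator (Ioc 0 1) (fun t : ℝ => ∑ n ∈ Finset.range K, a n * (t : ℂ) ^ n) t

theorem taylorRemainder_of_forall_eq_zero {g : ℝ → ℂ} {a : ℕ → ℂ} {K : ℕ}
    (h : ∀ n < K, a n = 0) : taylorRemainder g a K = g := by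
  have hz : (fun t : ℝ => ∑ n ∈ Finset.range K, a n * (t : ℂ) ^ n) = 0 := by
    funext t
    exact Finset.sum_eq_zero fun n hn => by rw [h n (Finset.mem_range.1 hn), zero_mul]
  funext t
  rw [taylorRemainder, hz]
  simp

/-- The functions `g` with an asymptotic expansion `∑ aₙ tⁿ` at `0` and rapid decay at infinity. -/
structure RapidDecayWithExpansion (g : ℝ → ℂ) (a : ℕ → ℂ) : Prop where
  continuousOn : ContinuousOn g (Ioi 0)
  isBigO_atTop : ∀ r : ℝ, g =O[atTop] (fun t : ℝ => t ^ (-r))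
  isBigO_zero : ∀ K : ℕ, (fun t : ℝ => g t - ∑ n ∈ Finset.range K, a n * (t : ℂ) ^ n)
    =O[𝓝[>] 0] (fun t : ℝ => t ^ K)

variable {g : ℝ → ℂ} {a : ℕ → ℂ}

theorem RapidDecayWithExpansion.locallyIntegrableOn (h : RapidDecayWithExpansion g a) (M K : ℕ) :
    LocallyIntegrableOn (fun t : ℝ => taylorRemainder g a K t / (t : ℂ) ^ M) (Ioi 0) := by
  have hne : ∀ t ∈ Ioi (0 : ℝ), (t : ℂ) ^ M ≠ 0 := fun t ht =>
    pow_ne_zero _ (Complex.ofReal_ne_zero.2 (ne_of_gt ht))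
  have h1 : LocallyIntegrableOn (fun t : ℝ => g t / (t : ℂ) ^ M) (Ioi 0) :=
    (h.continuousOn.div (by fun_prop) hne).locallyIntegrableOn measurableSet_Ioi
  have h2 : LocallyIntegrableOn
      (fun t : ℝ => (∑ n ∈ Finset.range K, a n * (t : ℂ) ^ n) / (t : ℂ) ^ M) (Ioi 0) :=
    (ContinuousOn.div (by fun_prop) (by fun_prop) hne).locallyIntegrableOn measurableSet_Ioi
  have h3 : LocallyIntegrableOn (indicator (Ioc 0 1)
      (fun t : ℝ => (∑ n ∈ Finset.range K, a n * (t : ℂ) ^ n) / (t : ℂ) ^ M)) (Ioi 0) :=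
    fun x hx => by
      obtain ⟨u, hu, hi⟩ := h2 x hx
      exact ⟨u, hu, hi.indicator measurableSet_Ioc⟩
  convert h1.sub h3 using 1
  funext t
  by_cases ht : t ∈ Ioc (0 : ℝ) 1
  · simp [taylorRemainder, ht, sub_div]
  · simp [taylorRemainder, ht]

theorem RapidDecayWithExpansion.remainder_isBigO_atTop (h : RapidDecayWithExpansion g a) (M K : ℕ)
    (r : ℝ) : (fun t : ℝ => taylorRemainder g a K t / (t : ℂ) ^ M)
      =O[atTop] (fun t : ℝ => t ^ (-r)) := by
  refine IsBigO.trans (IsBigO.of_bound 1 ?_) (h.isBigO_atTop r)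
  filter_upwards [eventually_gt_atTop 1] with t ht
  have h1 : t ∉ Ioc (0 : ℝ) 1 := fun h => absurd h.2 (not_le.2 ht)
  rw [taylorRemainder, indicator_of_notMem h1, sub_zero, norm_div, norm_pow, Complex.norm_real,
    one_mul]
  exact div_le_self (norm_nonneg _) 
    (one_le_pow₀ (ht.le.trans (le_abs_self t)))

theorem RapidDecayWithExpansion.remainder_isBigO_zero (h : RapidDecayWithExpansion g a)
    (M K : ℕ) : (fun t : ℝ => taylorRemainder g a K t / (t : ℂ) ^ M)
      =O[𝓝[>] 0] (fun t : ℝ => t ^ (-((M : ℝ) - K))) := by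
  have h1 : (fun t : ℝ => ((t : ℂ) ^ M)⁻¹) =O[𝓝[>] 0] (fun t : ℝ => (t ^ M)⁻¹) :=
    IsBigO.of_bound 1 (Eventually.of_forall fun t => by simp)
  refine ((h.isBigO_zero K).mul h1).congr' ?_ ?_
  · filter_upwards [Ioc_mem_nhdsGT (zero_lt_one' ℝ)] with t ht
    rw [taylorRemainder, indicator_of_mem ht, div_eq_mul_inv]
  · filter_upwards [self_mem_nhdsWithin] with t ht
    rw [neg_sub, Real.rpow_sub ht, Real.rpow_natCast, Real.rpow_natCast, div_eq_mul_inv]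

theorem RapidDecayWithExpansion.mellinConvergent_remainder (h : RapidDecayWithExpansion g a)
    (M K : ℕ) {s : ℂ} (hs : (M : ℝ) - K < s.re) :
    MellinConvergent (fun t : ℝ => taylorRemainder g a K t / (t : ℂ) ^ M) s :=
  mellinConvergent_of_isBigO_rpow (h.locallyIntegrableOn M K)
    (h.remainder_isBigO_atTop M K (s.re + 1)) (by simp) (h.remainder_isBigO_zero M K) hs

theorem RapidDecayWithExpansion.differentiableAt_mellin_remainder
    (h : RapidDecayWithExpansion g a) (M K : ℕ) {s : ℂ} (hs : (M : ℝ) - K < s.re) :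
    DifferentiableAt ℂ (mellin fun t : ℝ => taylorRemainder g a K t / (t : ℂ) ^ M) s :=
  mellin_differentiableAt_of_isBigO_rpow (h.locallyIntegrableOn M K)
    (h.remainder_isBigO_atTop M K (s.re + 1)) (by simp) (h.remainder_isBigO_zero M K) hs

/-- Passing from `K` to `K + 1` subtracts one more term `a K t^{K-M}` on `(0, 1]`, whose Mellin
transform is `a K / (s + K - M)`. -/
theorem RapidDecayWithExpansion.mellin_remainder_succ (h : RapidDecayWithExpansion g a)
    (M K : ℕ) {s : ℂ} (hs : (M : ℝ) - K < s.re) :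
    mellin (fun t : ℝ => taylorRemainder g a K t / (t : ℂ) ^ M) s =
      mellin (fun t : ℝ => taylorRemainder g a (K + 1) t / (t : ℂ) ^ M) s +
        a K / (s + (K - M)) := by
  have hs2 : (M : ℝ) - (K + 1 : ℕ) < s.re := by push_cast; linarith
  have hc := hasMellin_cpow_Ioc ((K : ℂ) - M) (s := s) (by simp; linarith)
  have hc2 := hasMellin_const_smul hc.1 (a K)
  have h1 := hasMellin_add (h.mellinConvergent_remainder M (K + 1) hs2) hc2.1
  rw [hc2.2, hc.2] at h1
  rw [div_eq_mul_one_div, ← smul_eq_mul, ← h1.2]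
  refine setIntegral_congr_fun measurableSet_Ioi fun t ht => ?_
  have ht0 : (t : ℂ) ≠ 0 := Complex.ofReal_ne_zero.2 (ne_of_gt ht)
  dsimp only
  congr 1
  simp only [taylorRemainder, smul_eq_mul]
  by_cases hm : t ∈ Ioc (0 : ℝ) 1
  · simp only [indicator_of_mem hm, Finset.sum_range_succ, Complex.cpow_sub _ _ ht0,
      Complex.cpow_natCast]
    ring
  · simp only [indicator_of_notMem hm]
    ring

/-- The coefficient function of `a n` in the continued zeta function: a continuation of
`Γ(s)⁻¹ / (s + n - M)`. -/
noncomputable def zetaCoeff (M n : ℕ) (s : ℂ) : ℂ :=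
  if n < M then (Complex.Gamma s)⁻¹ / (s + (n - M))
  else dslope (fun s => (Complex.Gamma s)⁻¹) (M - n) s

/-- For `n ≥ M` the pole at `s = M - n` is cancelled by a zero of `1/Γ`, so the quotient is a
difference quotient of `1/Γ`; only `n < M` leaves the poles `1, …, M`. -/
theorem zetaCoeff_of_ne {M n : ℕ} {s : ℂ} (hs : s + (n - M) ≠ 0) :
    zetaCoeff M n s = (Complex.Gamma s)⁻¹ / (s + (n - M)) := by
  unfold zetaCoeff
  split_ifs with h
  · rfl
  · have hne : s ≠ M - n := fun h => hs (by rw [h]; ring)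
    have h0 : Complex.Gamma ((M : ℂ) - n) = 0 := by
      have := Complex.Gamma_neg_nat_eq_zero (n - M)
      rwa [Nat.cast_sub (not_lt.1 h), neg_sub] at this
    rw [dslope_of_ne _ hne, slope_def_field, h0, inv_zero, sub_zero]
    congr 1
    ring

theorem differentiableAt_zetaCoeff {M n : ℕ} {s : ℂ} (hs : s ∈ (zetaPoles M)ᶜ) :
    DifferentiableAt ℂ (zetaCoeff M n) s := by
  unfold zetaCoeff
  split_ifs with h
  · refine (Complex.differentiable_one_div_Gamma s).div (by fun_prop) fun h0 => hs ⟨M - n, ?_, ?_⟩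
    · exact ⟨by omega, by omega⟩
    · simp only [Nat.cast_sub h.le]
      linear_combination -h0
  · have := (Complex.differentiableOn_dslope (s := univ) (c := (M : ℂ) - n)
      (f := fun s => (Complex.Gamma s)⁻¹) univ_mem).2
      Complex.differentiable_one_div_Gamma.differentiableOn
    exact this.differentiableAt univ_mem

/-- The continuation of the zeta integral of `g` to the half-plane `M - K < Re s`. -/
noncomputable def zetaHalfPlane (g : ℝ → ℂ) (a : ℕ → ℂ) (M K : ℕ) (s : ℂ) : ℂ :=
  (Complex.Gamma s)⁻¹ * mellin (fun t : ℝ => taylorRemainder g a K t / (t : ℂ) ^ M) s +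
    ∑ n ∈ Finset.range K, a n * zetaCoeff M n s

theorem RapidDecayWithExpansion.zetaHalfPlane_eq_of_le (h : RapidDecayWithExpansion g a)
    {M K K' : ℕ} (hK : K ≤ K') {s : ℂ} (hs : (M : ℝ) - K < s.re) :
    zetaHalfPlane g a M K s = zetaHalfPlane g a M K' s := by
  induction K', hK using Nat.le_induction with
  | base => rfl
  | succ n hn ih =>
    have hn' : (K : ℝ) ≤ n := Nat.cast_le.2 hn
    have hs2 : (M : ℝ) - n < s.re := by linarith
    have hne : s + (n - M) ≠ 0 := fun h0 => by
      have := congrArg Complex.re h0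
      simp at this
      linarith
    rw [ih, zetaHalfPlane, zetaHalfPlane, h.mellin_remainder_succ M n hs2, Finset.sum_range_succ,
      zetaCoeff_of_ne hne]
    ring

/-- The half-plane formulas agree on overlaps and glue. The second clause serves twice: `K = 0` is
the original domain of the zeta integral, while `K = M + 1` gives an integral formula around `s =
0`. -/
theorem RapidDecayWithExpansion.exists_continuation (h : RapidDecayWithExpansion g a) (M : ℕ) :
    ∃ Z : ℂ → ℂ, AnalyticOnNhd ℂ Z (zetaPoles M)ᶜ ∧
      ∀ K : ℕ, (∀ n < K, a n = 0) → ∀ s : ℂ, (M : ℝ) - K < s.re →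
        Z s = (Complex.Gamma s)⁻¹ * mellin (fun t : ℝ => g t / (t : ℂ) ^ M) s := by
  -- The cutoff depends on `s`; the `+ 1` makes `M - K < Re s` strict.
  set Z : ℂ → ℂ := fun s => zetaHalfPlane g a M (⌊(M : ℝ) - s.re⌋₊ + 1) s
  have hZ : ∀ (K : ℕ) (s : ℂ), (M : ℝ) - K < s.re → Z s = zetaHalfPlane g a M K s := fun K s hs => by
    have h1 : (M : ℝ) - (⌊(M : ℝ) - s.re⌋₊ + 1 : ℕ) < s.re := by
      have := Nat.lt_floor_add_one ((M : ℝ) - s.re)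
      push_cast
      linarith
    rcases le_total K (⌊(M : ℝ) - s.re⌋₊ + 1) with hK | hK
    · exact (h.zetaHalfPlane_eq_of_le hK hs).symm
    · exact h.zetaHalfPlane_eq_of_le hK h1
  have hopen : IsOpen (zetaPoles M)ᶜ :=
    ((Set.finite_Icc 1 M).image _).isClosed.isOpen_compl
  refine ⟨Z, ?_, fun K hK s hs => ?_⟩
  · refine DifferentiableOn.analyticOnNhd (fun s hs => ?_) hopen
    obtain ⟨K, hK⟩ := exists_nat_gt ((M : ℝ) - s.re)
    have hK' : (M : ℝ) - K < s.re := by linarith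
    have he : Z =ᶠ[𝓝 s] zetaHalfPlane g a M K := by
      filter_upwards [(isOpen_lt continuous_const Complex.continuous_re).mem_nhds hK'] with z hz
      exact hZ K z hz
    refine (he.differentiableAt_iff.2 ?_).differentiableWithinAt
    refine ((Complex.differentiable_one_div_Gamma s).mul
      (h.differentiableAt_mellin_remainder M K hK')).add ?_
    exact DifferentiableAt.fun_sum fun n _ => (differentiableAt_zetaCoeff hs).const_mul _
  · rw [hZ K s hs, zetaHalfPlane]
    have h0 : ∀ n ∈ Finset.range K, a n = 0 := fun n hn => hK n (Finset.mem_range.1 hn)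
    rw [Finset.sum_eq_zero fun n hn => by rw [h0 n hn, zero_mul], add_zero]
    rw [taylorRemainder_of_forall_eq_zero hK]

end Continuation

/-! ### Expansions at zero and decay at infinity for the Ruijsenaars class. -/

theorem AnalyticAt.exists_isBigO_sub_sum_pow {h : ℂ → ℂ} (hh : AnalyticAt ℂ h 0) :
    ∃ a : ℕ → ℂ, ∀ K : ℕ, (fun t : ℝ => h t - ∑ n ∈ Finset.range K, a n * (t : ℂ) ^ n)
      =O[𝓝[>] 0] (fun t : ℝ => t ^ K) := by
  obtain ⟨p, hp⟩ := hh
  refine ⟨p.coeff, fun K => ?_⟩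
  have ht : Tendsto (fun t : ℝ => (t : ℂ)) (𝓝[>] 0) (𝓝 0) :=
    (Complex.continuous_ofReal.tendsto' 0 0 (by simp)).mono_left nhdsWithin_le_nhds
  refine ((hp.isBigO_sub_partialSum_pow K).comp_tendsto ht).congr' ?_ ?_ |>.trans
    (isBigO_refl (fun t : ℝ => t ^ K) _).norm_left
  · refine Eventually.of_forall fun t => ?_
    simp [FormalMultilinearSeries.partialSum, mul_comm]
  · exact Eventually.of_forall fun t => by simp

namespace IsRuijsenaars

variable {f : ℂ → ℂ}

theorem continuousOn (hf : IsRuijsenaars f) : ContinuousOn (fun t : ℝ => f t) (Ioi 0) :=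
  fun t ht => ((hf.analyticAt_of_re_pos t (by simpa using ht)).continuousAt.comp
    Complex.continuous_ofReal.continuousAt).continuousWithinAt

theorem exists_rapidDecayWithExpansion (hf : IsRuijsenaars f) {E E₁ : ℂ → ℂ}
    (hE₁ : Differentiable ℂ E₁) {m : ℕ} (hE : ∀ t, E t = t ^ m * E₁ t)
    (htop : ∀ r : ℝ, (fun t : ℝ => E t * f t) =O[atTop] (fun t : ℝ => t ^ (-r))) :
    ∃ a : ℕ → ℂ, RapidDecayWithExpansion (fun t : ℝ => E t * f t) a ∧ ∀ n < m, a n = 0 := by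
  have hEd : Differentiable ℂ E := by
    rw [funext hE]
    fun_prop
  have han : AnalyticAt ℂ (fun t => E₁ t * f t) 0 := (hE₁.analyticAt 0).mul hf.analyticAt_zero
  obtain ⟨c, hc⟩ := han.exists_isBigO_sub_sum_pow
  refine ⟨fun n => if n < m then 0 else c (n - m), ⟨?_, htop, fun K => ?_⟩, fun n hn => if_pos hn⟩
  · exact (hEd.continuous.comp Complex.continuous_ofReal).continuousOn.mul hf.continuousOn
  · have hm : (fun t : ℝ => (t : ℂ) ^ m) =O[𝓝[>] 0] (fun t : ℝ => t ^ m) :=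
      IsBigO.of_bound 1 (Eventually.of_forall fun t => by simp)
    rcases le_total K m with hK | hK
    · have h1 := hm.mul (hc 0)
      refine IsBigO.trans (h1.congr' (Eventually.of_forall fun t => ?_) EventuallyEq.rfl) ?_
      · have hz : ∑ n ∈ Finset.range K, (if n < m then 0 else c (n - m)) * (t : ℂ) ^ n = 0 :=
          Finset.sum_eq_zero fun n hn => by
            rw [if_pos (lt_of_lt_of_le (Finset.mem_range.1 hn) hK), zero_mul]
        dsimp only
        rw [hz]
        simp [hE, mul_assoc]
      · refine IsBigO.of_bound 1 ?_
        filter_upwards [Ioc_mem_nhdsGT (zero_lt_one' ℝ)] with t ht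
        simpa [abs_of_pos ht.1] using pow_le_pow_of_le_one ht.1.le ht.2 hK
    · obtain ⟨j, rfl⟩ := Nat.exists_eq_add_of_le hK
      refine (hm.mul (hc j)).congr' (Eventually.of_forall fun t => ?_)
        (Eventually.of_forall fun t => by ring)
      dsimp only
      rw [Finset.sum_range_add, Finset.sum_eq_zero (s := Finset.range m) fun n hn => by
          rw [if_pos (Finset.mem_range.1 hn), zero_mul], zero_add, mul_sub, Finset.mul_sum, hE]
      simp [pow_add, mul_assoc, mul_left_comm]

theorem isBigO_exp_mul (hf : IsRuijsenaars f) {w : ℂ} (hw : 0 < w.re) (r : ℝ) :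
    (fun t : ℝ => Complex.exp (-w * t) * f t) =O[atTop] (fun t : ℝ => t ^ (-r)) := by
  obtain ⟨p, hp⟩ := hf.polynomial_growth
  have h1 : (fun t : ℝ => Complex.exp (-w * t)) =O[atTop] (fun t : ℝ => t ^ (-r - p)) :=
    (IsBigO.of_bound 1 (Eventually.of_forall fun t => by simp [Complex.norm_exp])).trans
      (isLittleO_exp_neg_mul_rpow_atTop hw (-r - p)).isBigO
  refine (h1.mul hp).congr' EventuallyEq.rfl ?_
  filter_upwards [eventually_gt_atTop 0] with t ht
  rw [← Real.rpow_natCast, ← Real.rpow_add ht, sub_add_cancel]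

theorem exists_rapidDecayWithExpansion_exp (hf : IsRuijsenaars f) {w : ℂ} (hw : 0 < w.re) :
    ∃ a : ℕ → ℂ, RapidDecayWithExpansion (fun t : ℝ => Complex.exp (-w * t) * f t) a := by
  obtain ⟨a, ha, -⟩ := hf.exists_rapidDecayWithExpansion (E := fun t => Complex.exp (-w * t))
    (E₁ := fun t => Complex.exp (-w * t)) (m := 0) (by fun_prop) (by simp) (hf.isBigO_exp_mul hw)
  exact ⟨a, ha⟩

theorem isZetaContinuation_genZeta (hf : IsRuijsenaars f) (M : ℕ) {w : ℂ} (hw : 0 < w.re) :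
    IsZetaContinuation f M w (fun s => genZeta f M s w) := by
  obtain ⟨a, ha⟩ := hf.exists_rapidDecayWithExpansion_exp hw
  obtain ⟨Z, hZ, hZe⟩ := ha.exists_continuation M
  have h : ∃ Z, IsZetaContinuation f M w Z := ⟨Z, hZ, fun s hs => hZe 0 (by simp) s (by simpa)⟩
  have h2 := h.choose_spec
  simp only [genZeta, dif_pos h]
  exact h2

theorem mellinConvergent_exp (hf : IsRuijsenaars f) (M : ℕ) {w s : ℂ} (hw : 0 < w.re)
    (hs : (M : ℝ) < s.re) :
    MellinConvergent (fun t : ℝ => Complex.exp (-w * t) * f t / (t : ℂ) ^ M) s := by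
  obtain ⟨a, ha⟩ := hf.exists_rapidDecayWithExpansion_exp hw
  have h := ha.mellinConvergent_remainder M 0 (s := s) (by simpa)
  rwa [taylorRemainder_of_forall_eq_zero (by simp)] at h

end IsRuijsenaars

theorem zero_mem_compl_zetaPoles (M : ℕ) : (0 : ℂ) ∈ (zetaPoles M)ᶜ := by
  rintro ⟨k, hk, h0⟩
  have : k = 0 := Nat.cast_eq_zero.1 (show (k : ℂ) = 0 from h0)
  have := hk.1
  omega

theorem hasDerivAt_inv_Gamma_zero : HasDerivAt (fun s => (Complex.Gamma s)⁻¹) 1 0 := by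
  have h : HasDerivAt (fun s : ℂ => s * (Complex.Gamma (s + 1))⁻¹) 1 0 := by
    have h1 := ((Complex.differentiable_one_div_Gamma.comp
      (differentiable_id.add_const (1 : ℂ))) 0).hasDerivAt
    exact ((hasDerivAt_id (0 : ℂ)).fun_mul h1).congr_deriv (by simp)
  refine h.congr_of_eventuallyEq (Eventually.of_forall fun s => ?_)
  simpa using Complex.one_div_Gamma_eq_self_mul_one_div_Gamma_add_one s

/-- If the expansion of `g` at zero has no terms of order at most `M`, then the derivative at zero
of its zeta function is a convergent integral. -/
theorem RapidDecayWithExpansion.hasDerivAt_zero {g : ℝ → ℂ} {a : ℕ → ℂ}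
    (h : RapidDecayWithExpansion g a) {M : ℕ} (h0 : ∀ n < M + 1, a n = 0) :
    HasDerivAt (fun s => (Complex.Gamma s)⁻¹ * mellin (fun t : ℝ => g t / (t : ℂ) ^ M) s)
      (∫ t in Ioi (0 : ℝ), g t / (t : ℂ) ^ (M + 1)) 0 := by
  have h1 := h.differentiableAt_mellin_remainder M (M + 1) (s := 0) (by simp)
  rw [taylorRemainder_of_forall_eq_zero h0] at h1
  refine (hasDerivAt_inv_Gamma_zero.fun_mul h1.hasDerivAt).congr_deriv ?_
  rw [Complex.Gamma_zero, inv_zero, zero_mul, add_zero, one_mul]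
  refine setIntegral_congr_fun measurableSet_Ioi fun t ht => ?_
  have ht0 : (t : ℂ) ≠ 0 := Complex.ofReal_ne_zero.2 (ne_of_gt ht)
  dsimp only
  rw [zero_sub, Complex.cpow_neg_one, smul_eq_mul, pow_succ]
  field_simp

/-! ### The combinatorial operator -/

theorem altSum_eq_sum_powerset (N : ℕ) (b : ℕ → ℝ) (g : ℂ → ℂ) (q : ℂ) :
    altSum N b g q = ∑ K ∈ (Finset.Icc 1 N).powerset,
      (-1 : ℂ) ^ K.card * g (q + b 0 + ∑ k ∈ K, (b k : ℂ)) := by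
  rw [Finset.sum_powerset]
  simp only [altSum, Nat.card_Icc, Nat.add_sub_cancel]
  refine Finset.sum_congr rfl fun p _ => ?_
  rw [Finset.mul_sum]
  exact Finset.sum_congr rfl fun K hK => by rw [(Finset.mem_powersetCard.1 hK).2]

theorem altSum_exp (N : ℕ) (b : ℕ → ℝ) (q t : ℂ) :
    altSum N b (fun w => Complex.exp (-w * t)) q =
      Complex.exp (-(q + b 0) * t) * ∏ j ∈ Finset.Icc 1 N, (1 - Complex.exp (-b j * t)) := by
  rw [altSum_eq_sum_powerset]
  simp_rw [sub_eq_add_neg, Finset.prod_one_add, Finset.mul_sum, Finset.prod_neg,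
    ← Complex.exp_sum]
  refine Finset.sum_congr rfl fun K _ => ?_
  rw [mul_left_comm, ← Complex.exp_add, ← Finset.sum_mul, Finset.sum_neg_distrib]
  ring_nf

theorem re_altSum_argument_pos {b : ℕ → ℝ} (hb : ∀ k, 0 < b k) {q : ℂ} (hq : -b 0 < q.re)
    (K : Finset ℕ) : 0 < (q + b 0 + ∑ k ∈ K, (b k : ℂ)).re := by
  have h : 0 ≤ ∑ k ∈ K, b k := Finset.sum_nonneg fun k _ => (hb k).le
  simp
  linarith

theorem exists_differentiable_eq_mul {h : ℂ → ℂ} (hh : Differentiable ℂ h) (h0 : h 0 = 0) :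
    ∃ k : ℂ → ℂ, Differentiable ℂ k ∧ ∀ t, h t = t * k t := by
  refine ⟨dslope h 0, differentiableOn_univ.1
    ((Complex.differentiableOn_dslope univ_mem).2 hh.differentiableOn), fun t => ?_⟩
  simpa [h0] using (sub_smul_dslope h 0 t).symm

theorem exists_differentiable_prod_eq_pow_mul (N : ℕ) (b : ℕ → ℝ) :
    ∃ k : ℂ → ℂ, Differentiable ℂ k ∧
      ∀ t, ∏ j ∈ Finset.Icc 1 N, (1 - Complex.exp (-b j * t)) = t ^ N * k t := by
  have h := fun j : ℕ => exists_differentiable_eq_mul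
    (h := fun t => 1 - Complex.exp (-b j * t)) (by fun_prop) (by simp)
  choose k hk hk2 using h
  refine ⟨fun t => ∏ j ∈ Finset.Icc 1 N, k j t,
    Differentiable.fun_finsetProd fun j _ => hk j, fun t => ?_⟩
  simp_rw [hk2, Finset.prod_mul_distrib]
  simp

section Eta

variable {f : ℂ → ℂ} {b : ℕ → ℝ}

theorem IsRuijsenaars.isBigO_altSum_exp_mul (hf : IsRuijsenaars f) (hb : ∀ k, 0 < b k) (N : ℕ)
    {q : ℂ} (hq : -b 0 < q.re) (r : ℝ) :
    (fun t : ℝ => altSum N b (fun w => Complex.exp (-w * t)) q * f t)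
      =O[atTop] (fun t : ℝ => t ^ (-r)) := by
  simp_rw [altSum_eq_sum_powerset, Finset.sum_mul, mul_assoc]
  exact IsBigO.fun_sum fun K _ =>
    (hf.isBigO_exp_mul (re_altSum_argument_pos hb hq K) r).const_mul_left _

theorem IsRuijsenaars.exists_expansion_altSum_exp (hf : IsRuijsenaars f) (hb : ∀ k, 0 < b k)
    (N : ℕ) {q : ℂ} (hq : -b 0 < q.re) :
    ∃ a, RapidDecayWithExpansion
      (fun t : ℝ => altSum N b (fun w => Complex.exp (-w * t)) q * f t) a ∧ ∀ n < N, a n = 0 := by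
  obtain ⟨k, hk, hk2⟩ := exists_differentiable_prod_eq_pow_mul N b
  refine hf.exists_rapidDecayWithExpansion
    (E := fun t => altSum N b (fun w => Complex.exp (-w * t)) q)
    (E₁ := fun t => Complex.exp (-(q + b 0) * t) * k t) (by fun_prop) (fun t => ?_)
    (hf.isBigO_altSum_exp_mul hb N hq)
  rw [altSum_exp, hk2]
  ring

theorem IsRuijsenaars.exists_expansion_altSum_exp_sub (hf : IsRuijsenaars f) (hb : ∀ k, 0 < b k)
    (N : ℕ) {q : ℂ} (hq : -b 0 < q.re) :
    ∃ a, RapidDecayWithExpansion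
      (fun t : ℝ => (altSum N b (fun w => Complex.exp (-w * t)) q -
        altSum N b (fun w => Complex.exp (-w * t)) 0) * f t) a ∧ ∀ n < N + 1, a n = 0 := by
  obtain ⟨k, hk, hk2⟩ := exists_differentiable_prod_eq_pow_mul N b
  obtain ⟨l, hl, hl2⟩ := exists_differentiable_eq_mul
    (h := fun t => Complex.exp (-q * t) - 1) (by fun_prop) (by simp)
  refine hf.exists_rapidDecayWithExpansion
    (E := fun t => altSum N b (fun w => Complex.exp (-w * t)) q -
        altSum N b (fun w => Complex.exp (-w * t)) 0)
    (E₁ := fun t => l t * (Complex.exp (-b 0 * t) * k t)) (by fun_prop) (fun t => ?_) fun r => ?_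
  · have h1 : Complex.exp (-(q + b 0) * t) = Complex.exp (-q * t) * Complex.exp (-b 0 * t) := by
      rw [← Complex.exp_add]; ring_nf
    rw [altSum_exp, altSum_exp, hk2, h1, zero_add]
    linear_combination t ^ N * k t * Complex.exp (-b 0 * t) * hl2 t
  · simp_rw [sub_mul]
    exact (hf.isBigO_altSum_exp_mul hb N hq r).sub
      (hf.isBigO_altSum_exp_mul hb N (by simpa using hb 0) r)

theorem ofReal_levyDensity (hpos : ∀ t : ℝ, 0 ≤ t → (f t).im = 0 ∧ 0 < (f t).re) (M N : ℕ)
    {t : ℝ} (ht : 0 < t) :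
    (levyDensity f M N b t : ℂ) =
      altSum N b (fun w => Complex.exp (-w * t)) 0 * f t / (t : ℂ) ^ (M + 1) := by
  have hre : ((f t).re : ℂ) = f t := Complex.ext (by simp) (by simp [(hpos t ht.le).1])
  rw [altSum_exp, levyDensity]
  push_cast
  rw [hre, zero_add]

theorem IsRuijsenaars.isZetaContinuation_altSum_sub (hf : IsRuijsenaars f) (hb : ∀ k, 0 < b k)
    (M N : ℕ) {q : ℂ} (hq : -b 0 < q.re) :
    IsZetaContinuation (fun z => (altSum N b (fun w => Complex.exp (-w * z)) q -
        altSum N b (fun w => Complex.exp (-w * z)) 0) * f z) M 0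
      (fun s => altSum N b (genZeta f M s) q - altSum N b (genZeta f M s) 0) := by
  have h0 : -b 0 < (0 : ℂ).re := by simpa using hb 0
  have hZ : ∀ {q : ℂ}, -b 0 < q.re → ∀ K : Finset ℕ, _ := fun hq K =>
    hf.isZetaContinuation_genZeta M (re_altSum_argument_pos hb hq K)
  have hC : ∀ {q : ℂ}, -b 0 < q.re → ∀ {s : ℂ}, (M : ℝ) < s.re →
      HasMellin (fun t : ℝ => altSum N b (fun w => Complex.exp (-w * t)) q * f t / (t : ℂ) ^ M) s
        (Complex.Gamma s * altSum N b (genZeta f M s) q) := by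
    intro q hq s hs
    have hi : ∀ K : Finset ℕ, _ := fun K => (hasMellin_const_smul (hf.mellinConvergent_exp M
      (re_altSum_argument_pos hb hq K) hs) ((-1 : ℂ) ^ K.card))
    have hG : Complex.Gamma s ≠ 0 :=
      Complex.Gamma_ne_zero_of_re_pos ((Nat.cast_nonneg M).trans_lt hs)
    have he : ∀ t : ℝ, (t : ℂ) ^ (s - 1) • (altSum N b (fun w => Complex.exp (-w * t)) q * f t /
        (t : ℂ) ^ M) = ∑ K ∈ (Finset.Icc 1 N).powerset, (t : ℂ) ^ (s - 1) • ((-1 : ℂ) ^ K.card •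
          (Complex.exp (-(q + b 0 + ∑ k ∈ K, (b k : ℂ)) * t) * f t / (t : ℂ) ^ M)) := fun t => by
      rw [altSum_eq_sum_powerset, Finset.sum_mul, Finset.sum_div, Finset.smul_sum]
      exact Finset.sum_congr rfl fun K _ => by simp only [smul_eq_mul]; ring
    refine ⟨?_, ?_⟩
    · unfold MellinConvergent
      simp_rw [he]
      exact integrable_finsetSum _ fun K _ => (hi K).1
    · unfold mellin
      simp_rw [he]
      rw [integral_finsetSum _ fun K _ => (hi K).1, altSum_eq_sum_powerset, Finset.mul_sum]
      refine Finset.sum_congr rfl fun K _ => ?_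
      refine (hi K).2.trans ?_
      have h := (hZ hq K).2 s hs
      dsimp only at h
      rw [h, zetaIntegral, smul_eq_mul]
      field_simp
  refine ⟨?_, fun s hs => ?_⟩
  · simp_rw [altSum_eq_sum_powerset]
    exact (Finset.analyticOnNhd_fun_sum _ fun K _ => analyticOnNhd_const.mul (hZ hq K).1).sub
      (Finset.analyticOnNhd_fun_sum _ fun K _ => analyticOnNhd_const.mul (hZ h0 K).1)
  · have hG : Complex.Gamma s ≠ 0 :=
      Complex.Gamma_ne_zero_of_re_pos ((Nat.cast_nonneg M).trans_lt hs)
    have h := (hasMellin_sub (hC hq hs).1 (hC h0 hs).1).2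
    rw [(hC hq hs).2, (hC h0 hs).2] at h
    simp only [zetaIntegral, neg_zero, zero_mul, Complex.exp_zero, one_mul, sub_mul, sub_div]
    rw [h]
    field_simp

theorem IsRuijsenaars.altSum_genLogGamma_sub (hf : IsRuijsenaars f)
    (hpos : ∀ t : ℝ, 0 ≤ t → (f t).im = 0 ∧ 0 < (f t).re) (hb : ∀ k, 0 < b k) {M N : ℕ}
    (hMN : M ≤ N) {q : ℂ} (hq : -b 0 < q.re) :
    altSum N b (genLogGamma f M) q - altSum N b (genLogGamma f M) 0 =
      ∫ t in Ioi (0 : ℝ), (Complex.exp (-q * t) - 1) * (levyDensity f M N b t : ℂ) := by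
  have h0 : -b 0 < (0 : ℂ).re := by simpa using hb 0
  have hd : ∀ {q : ℂ}, -b 0 < q.re → HasDerivAt (fun s => altSum N b (genZeta f M s) q)
      (altSum N b (genLogGamma f M) q) 0 := fun hq => by
    simp_rw [altSum_eq_sum_powerset]
    exact HasDerivAt.fun_sum fun K _ => (((hf.isZetaContinuation_genZeta M
      (re_altSum_argument_pos hb hq K)).1 0
        (zero_mem_compl_zetaPoles M)).differentiableAt.hasDerivAt).const_mul _
  obtain ⟨a, ha, ha0⟩ := hf.exists_expansion_altSum_exp_sub hb N hq
  have ha0' : ∀ n < M + 1, a n = 0 := fun n hn => ha0 n (by omega)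
  obtain ⟨Z, hZ, hZe⟩ := ha.exists_continuation M
  have hZc : IsZetaContinuation (fun z => (altSum N b (fun w => Complex.exp (-w * z)) q -
        altSum N b (fun w => Complex.exp (-w * z)) 0) * f z) M 0 Z :=
    ⟨hZ, fun s hs => by simpa [zetaIntegral] using hZe 0 (by simp) s (by simpa)⟩
  have heq := (hf.isZetaContinuation_altSum_sub hb M N hq).eqOn hZc
  have hopen : IsOpen ((zetaPoles M)ᶜ ∩ {s : ℂ | -1 < s.re}) :=
    ((Set.finite_Icc 1 M).image _).isClosed.isOpen_compl.inter
      (isOpen_lt continuous_const Complex.continuous_re)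
  have hev : (fun s => altSum N b (genZeta f M s) q - altSum N b (genZeta f M s) 0) =ᶠ[𝓝 0]
      fun s => (Complex.Gamma s)⁻¹ * mellin (fun t : ℝ =>
        (altSum N b (fun w => Complex.exp (-w * t)) q -
          altSum N b (fun w => Complex.exp (-w * t)) 0) * f t / (t : ℂ) ^ M) s := by
    filter_upwards [hopen.mem_nhds ⟨zero_mem_compl_zetaPoles M, by simp⟩] with s hs
    exact (heq hs.1).trans (hZe (M + 1) ha0' s (by simpa using hs.2))
  rw [((hd hq).sub (hd h0)).unique ((ha.hasDerivAt_zero ha0').congr_of_eventuallyEq hev)]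
  refine setIntegral_congr_fun measurableSet_Ioi fun t ht => ?_
  have h1 : Complex.exp (-(q + b 0) * t) = Complex.exp (-q * t) * Complex.exp (-b 0 * t) := by
    rw [← Complex.exp_add]; ring_nf
  simp only [ofReal_levyDensity hpos M N ht, altSum_exp, h1, zero_add]
  ring

/-- `t e^{ct}` is integrable against the Lévy density for `c < b₀`. -/
theorem IsRuijsenaars.integrableOn_mul_exp_mul_levyDensity (hf : IsRuijsenaars f)
    (hpos : ∀ t : ℝ, 0 ≤ t → (f t).im = 0 ∧ 0 < (f t).re) (hb : ∀ k, 0 < b k) {M N : ℕ}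
    (hMN : M ≤ N) {c : ℝ} (hc : c < b 0) :
    IntegrableOn (fun t : ℝ => t * Real.exp (c * t) * levyDensity f M N b t) (Ioi 0) := by
  obtain ⟨a, ha, ha0⟩ := hf.exists_expansion_altSum_exp hb N (q := -(c : ℂ)) (by simpa using hc)
  have h := ha.mellinConvergent_remainder M M (s := 1) (by simp)
  rw [taylorRemainder_of_forall_eq_zero fun n hn => ha0 n (hn.trans_le hMN)] at h
  refine IntegrableOn.congr_fun h.re (fun t ht => ?_) measurableSet_Ioi
  have ht0 : (t : ℂ) ≠ 0 := Complex.ofReal_ne_zero.2 (ne_of_gt ht)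
  have h1 : Complex.exp (-(-(c : ℂ) + b 0) * t) =
      Complex.exp (c * t) * Complex.exp (-b 0 * t) := by
    rw [← Complex.exp_add]; ring_nf
  have h2 : (t : ℂ) ^ ((1 : ℂ) - 1) • (altSum N b (fun w => Complex.exp (-w * t)) (-(c : ℂ)) * f t /
      (t : ℂ) ^ M) = ((t * Real.exp (c * t) * levyDensity f M N b t : ℝ) : ℂ) := by
    push_cast
    rw [ofReal_levyDensity hpos M N ht, altSum_exp, altSum_exp, h1, sub_self, Complex.cpow_zero,
      one_smul, zero_add]
    field_simp
    ring
  dsimp only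
  rw [h2]
  exact Complex.ofReal_re _

end Eta

/-- `t e^{at}` is integrable against `k` on `(0, ∞)` for all `a < c`. -/
structure HasExpMoments (k : ℝ → ℝ) (c : ℝ) : Prop where
  pos : 0 < c
  nonneg : ∀ t, 0 < t → 0 ≤ k t
  integrableOn : ∀ a < c, IntegrableOn (fun t : ℝ => t * Real.exp (a * t) * k t) (Ioi 0)

namespace HasExpMoments

variable {k : ℝ → ℝ} {c : ℝ}

theorem aemeasurable (h : HasExpMoments k c) : AEMeasurable k (volume.restrict (Ioi 0)) := by
  have h1 : AEMeasurable (fun t : ℝ => t⁻¹ * (t * Real.exp (0 * t) * k t))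
      (volume.restrict (Ioi 0)) :=
    measurable_inv.aemeasurable.mul (h.integrableOn 0 h.pos).aemeasurable
  refine h1.congr ((ae_restrict_mem measurableSet_Ioi).mono fun t ht => ?_)
  have : t ≠ 0 := ne_of_gt ht
  simp [this]

theorem div_natCast (h : HasExpMoments k c) (n : ℕ) : HasExpMoments (fun t => k t / n) c where
  pos := h.pos
  nonneg t ht := div_nonneg (h.nonneg t ht) n.cast_nonneg
  integrableOn a ha := by
    simpa only [IntegrableOn, mul_div_assoc] using (h.integrableOn a ha).div_const (n : ℝ)

theorem isLevyDensity (h : HasExpMoments k c) : IsLevyDensity k := by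
  refine ⟨h.nonneg, (h.integrableOn 0 h.pos).mono'
    ((by fun_prop : AEMeasurable (fun t : ℝ => min 1 t) _).mul
      h.aemeasurable).aestronglyMeasurable ?_⟩
  refine (ae_restrict_mem measurableSet_Ioi).mono fun t ht => ?_
  have ht' : (0 : ℝ) < t := ht
  rw [Real.norm_of_nonneg (mul_nonneg (le_min zero_le_one ht'.le) (h.nonneg t ht))]
  simpa using mul_le_mul_of_nonneg_right (min_le_right 1 t) (h.nonneg t ht)

theorem integrableOn_cexp_sub_one_mul (h : HasExpMoments k c) {z : ℂ} (hz : z.re < c) :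
    IntegrableOn (fun t : ℝ => (Complex.exp (z * t) - 1) * (k t : ℂ)) (Ioi 0) := by
  refine ((h.integrableOn (max z.re 0) (max_lt hz h.pos)).const_mul ‖z‖).mono'
    (by have := h.aemeasurable; fun_prop) ?_
  refine (ae_restrict_mem measurableSet_Ioi).mono fun t ht => ?_
  have ht' : (0 : ℝ) < t := ht
  have h1 : max (z * t).re 0 = max z.re 0 * t := by
    rw [max_mul_of_nonneg _ _ ht'.le]; simp
  have h2 := norm_cexp_sub_one_le (z * t)
  rw [h1, norm_mul, Complex.norm_real, Real.norm_of_nonneg ht'.le] at h2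
  rw [norm_mul, Complex.norm_real, Real.norm_of_nonneg (h.nonneg t ht)]
  refine (mul_le_mul_of_nonneg_right h2 (h.nonneg t ht)).trans_eq (by ring)

/-- The existence half of the Lévy–Khinchine theorem for subordinators with exponential moments. -/
theorem exists_measure (h : HasExpMoments k c) :
    ∃ ν : Measure ℝ, IsProbabilityMeasure ν ∧ ν (Ici 0) = 1 ∧ ∀ z : ℂ, z.re < c →
      Integrable (fun x : ℝ => Complex.exp (z * x)) ν ∧
      ∫ x : ℝ, Complex.exp (z * x) ∂ν =
        Complex.exp (∫ t in Ioi (0 : ℝ), (Complex.exp (z * t) - 1) * (k t : ℂ)) := by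
  set D : ℝ → ℝ≥0 := fun t => (k t).toNNReal
  have hD : AEMeasurable D (volume.restrict (Ioi 0)) := h.aemeasurable.real_toNNReal
  set Λ : Measure ℝ≥0 :=
    ((volume.restrict (Ioi 0)).withDensity fun t => (D t : ℝ≥0∞)).map Real.toNNReal
  have hΛ : ∀ a < c, Integrable (fun t : ℝ≥0 => (t : ℝ) * Real.exp (a * t)) Λ := fun a ha => by
    rw [integrable_map_measure (by fun_prop) (by fun_prop),
      integrable_withDensity_iff_integrable_smul₀ hD]
    refine (h.integrableOn a ha).congr ((ae_restrict_mem measurableSet_Ioi).mono fun t ht => ?_)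
    simp [D, NNReal.smul_def, h.nonneg t ht, le_of_lt (mem_Ioi.1 ht)]
    ring
  have hint : ∀ z : ℂ, ∫ t : ℝ≥0, (Complex.exp (z * (t : ℝ)) - 1) ∂Λ =
      ∫ t in Ioi (0 : ℝ), (Complex.exp (z * t) - 1) * (k t : ℂ) := fun z => by
    rw [integral_map (by fun_prop) (by fun_prop), integral_withDensity_eq_integral_smul₀ hD]
    refine setIntegral_congr_fun measurableSet_Ioi fun t ht => ?_
    simp [D, NNReal.smul_def, h.nonneg t ht, le_of_lt (mem_Ioi.1 ht), mul_comm]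
  obtain ⟨ν, hν, hν2⟩ := exists_isProbabilityMeasure_integral_cexp_eq Λ h.pos hΛ
  have hm : Measurable ((↑) : ℝ≥0 → ℝ) := measurable_subtype_coe
  refine ⟨ν.map (↑), Measure.isProbabilityMeasure_map hm.aemeasurable, ?_, fun z hz => ?_⟩
  · rw [Measure.map_apply hm measurableSet_Ici]
    have : ((↑) : ℝ≥0 → ℝ) ⁻¹' Ici 0 = univ := eq_univ_of_forall fun x => x.coe_nonneg
    rw [this, measure_univ]
  · rw [integrable_map_measure (by fun_prop) hm.aemeasurable,
      integral_map hm.aemeasurable (by fun_prop), ← hint]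
    exact hν2 z hz

theorem infinitelyDivisibleOnNonneg (h : HasExpMoments k c) {ν : Measure ℝ}
    [IsProbabilityMeasure ν] (hν0 : ν (Ici 0) = 1)
    (hν : ∀ z : ℂ, z.re < c → ∫ x : ℝ, Complex.exp (z * x) ∂ν =
      Complex.exp (∫ t in Ioi (0 : ℝ), (Complex.exp (z * t) - 1) * (k t : ℂ))) :
    InfinitelyDivisibleOnNonneg ν := by
  refine ⟨inferInstance, hν0, fun n hn => ?_⟩
  obtain ⟨ρ, hρ, hρ0, hρ2⟩ := (h.div_natCast n).exists_measure
  refine ⟨ρ, hρ, hρ0, ?_⟩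
  have : IsProbabilityMeasure ((Measure.pi fun _ : Fin n => ρ).map fun x => ∑ i, x i) :=
    Measure.isProbabilityMeasure_map (by fun_prop)
  refine Measure.ext_of_charFun ?_
  rw [ProbabilityTheory.charFun_map_sum_pi_eq_prod]
  funext ξ
  have hz : (ξ * Complex.I).re < c := by simpa using h.pos
  have he : ∀ x : ℝ, (ξ : ℂ) * x * Complex.I = ξ * Complex.I * x := fun x => by ring
  rw [Finset.prod_const, Finset.card_univ, Fintype.card_fin, Pi.pow_apply, charFun_apply_real,
    charFun_apply_real]
  simp_rw [he]
  rw [hν _ hz, (hρ2 _ hz).2, ← Complex.exp_nat_mul, ← integral_const_mul]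
  have hn0 : (n : ℂ) ≠ 0 := Nat.cast_ne_zero.2 (by omega)
  congr 1
  refine integral_congr_ae (Filter.Eventually.of_forall fun t => ?_)
  push_cast
  field_simp

end HasExpMoments

theorem IsRuijsenaars.hasExpMoments_levyDensity {f : ℂ → ℂ} (hf : IsRuijsenaars f)
    (hpos : ∀ t : ℝ, 0 ≤ t → (f t).im = 0 ∧ 0 < (f t).re)
    {b : ℕ → ℝ} (hb : ∀ k, 0 < b k) {M N : ℕ} (hMN : M ≤ N) :
    HasExpMoments (levyDensity f M N b) (b 0) where
  pos := hb 0
  nonneg t ht := by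
    refine div_nonneg (mul_nonneg (mul_nonneg (Real.exp_pos _).le
      (Finset.prod_nonneg fun j _ => ?_)) (hpos t ht.le).2.le) (pow_nonneg ht.le _)
    have : -b j * t ≤ 0 := by nlinarith [hb j]
    linarith [Real.exp_le_one_iff.2 this]
  integrableOn _ ha := hf.integrableOn_mul_exp_mul_levyDensity hpos hb hMN ha

theorem mainTheorem1 (f : ℂ → ℂ) (hf : IsRuijsenaars f)
    (hpos : ∀ t : ℝ, 0 ≤ t → (f t).im = 0 ∧ 0 < (f t).re)
    (b : ℕ → ℝ) (hb : ∀ k, 0 < b k) (M N : ℕ) (hMN : M ≤ N) :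
    ∃ β : Measure ℝ, IsProbabilityMeasure β ∧ β (Ioc 0 1) = 1 ∧
      (∀ q : ℂ, -b 0 < q.re →
        Integrable (fun x : ℝ => (x : ℂ) ^ q) β ∧
        ∫ x : ℝ, (x : ℂ) ^ q ∂β = barnesEta f M N b q) ∧
      InfinitelyDivisibleOnNonneg (β.map (fun x : ℝ => -Real.log x)) ∧
      IsLevyDensity (levyDensity f M N b) ∧
      (∀ q : ℂ, q.re < b 0 →
        Integrable (fun x : ℝ => Complex.exp (-q * (Real.log x : ℂ))) β ∧
        IntegrableOn (fun t : ℝ => (Complex.exp (t * q) - 1) * (levyDensity f M N b t : ℂ))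
          (Ioi 0) ∧
        ∫ x : ℝ, Complex.exp (-q * (Real.log x : ℂ)) ∂β =
          Complex.exp (∫ t in Ioi (0 : ℝ),
            (Complex.exp (t * q) - 1) * (levyDensity f M N b t : ℂ))) := by
  have hk := hf.hasExpMoments_levyDensity hpos hb hMN
  obtain ⟨ν, hν, hν0, hν2⟩ := hk.exists_measure
  have hm : Measurable fun x : ℝ => Real.exp (-x) := by fun_prop
  have hlog : (fun x : ℝ => -Real.log x) ∘ (fun x : ℝ => Real.exp (-x)) = id := by
    funext x
    simp
  have hmap : (ν.map fun x : ℝ => Real.exp (-x)).map (fun x : ℝ => -Real.log x) = ν := by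
    rw [Measure.map_map (by fun_prop) hm, hlog, Measure.map_id]
  have hexp : ∀ q : ℂ, q.re < b 0 →
      Integrable (fun x : ℝ => Complex.exp (-q * (Real.log x : ℂ)))
        (ν.map fun x : ℝ => Real.exp (-x)) ∧
      ∫ x : ℝ, Complex.exp (-q * (Real.log x : ℂ)) ∂(ν.map fun x : ℝ => Real.exp (-x)) =
        Complex.exp (∫ t in Ioi (0 : ℝ),
          (Complex.exp (q * t) - 1) * (levyDensity f M N b t : ℂ)) := fun q hq => by
    rw [integrable_map_measure (by fun_prop) hm.aemeasurable,
      integral_map hm.aemeasurable (by fun_prop)]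
    simpa [Function.comp_def] using hν2 q hq
  have hIoc : (ν.map fun x : ℝ => Real.exp (-x)) (Ioc 0 1) = 1 := by
    have : (fun x : ℝ => Real.exp (-x)) ⁻¹' Ioc 0 1 = Ici 0 := by
      ext x
      simp [Real.exp_pos]
    rw [Measure.map_apply hm measurableSet_Ioc, this, hν0]
  have hprob := Measure.isProbabilityMeasure_map (μ := ν) hm.aemeasurable
  refine ⟨ν.map fun x : ℝ => Real.exp (-x), hprob, hIoc, fun q hq => ?_, ?_,
    hk.isLevyDensity, fun q hq => ?_⟩
  · have hpow : (fun x : ℝ => Complex.exp (-(-q) * (Real.log x : ℂ)))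
        =ᵐ[ν.map fun x : ℝ => Real.exp (-x)] fun x : ℝ => (x : ℂ) ^ q := by
      filter_upwards [(prob_compl_eq_zero_iff measurableSet_Ioc).2 hIoc] with x hx
      rw [Complex.cpow_def_of_ne_zero (Complex.ofReal_ne_zero.2 (ne_of_gt hx.1)), neg_neg,
        Complex.ofReal_log hx.1.le, mul_comm]
    have h := hexp (-q) (by simpa [neg_lt] using hq)
    rw [integrable_congr hpow, integral_congr_ae hpow] at h
    rw [barnesEta, hf.altSum_genLogGamma_sub hpos hb hMN hq]
    exact h
  · rw [hmap]
    exact hk.infinitelyDivisibleOnNonneg hν0 fun z hz => (hν2 z hz).2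
  · simp_rw [mul_comm _ q]
    exact ⟨(hexp q hq).1, hk.integrableOn_cexp_sub_one_mul hq, (hexp q hq).2⟩
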